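/- For a finite simple graph $G$ and $S\subseteq V(G)$ let $B(S)$ be the set of vertices outside $S$ adjacent to some vertex of $S$. Let $B_{i,j}(G)$ be the number of $S\subseteq V(G)$ with $|B(S)|=i$, $|S|=j$, and let $B(G;x,y)=\sum_{S\subseteq V(G)}x^{|B(S)|}y^{|S|}$. For finite graphs $G_1,G_2$ of order at least $2$ without isolated vertices, consider the planar system $$\dot x=-y+B(G_1;x,y)-1,\qquad \dot y=x+B(G_2;x,y)-1 .$$ Its Liapunov number at the origin is $d'''(0)$, where $d(s)=P(s)-s$ and $P$ is the Poincaré map of the origin on the positive $x$-axis: for small $s>0$, $P(s)$ is the radius at which the solution starting at $(s,0)$ first completes a full turn (polar angle $2\pi$) around the origin. Put $$\sigma_B=\tfrac{3\pi}{2}\bigl(3B_{0,3}(G_2)+B_{1,2}(G_1)+B_{2,1}(G_2)+2B_{0,2}(G_1)B_{0,2}(G_2)+B_{1,1}(G_1)B_{0,2}(G_1)-B_{1,1}(G_2)B_{0,2}(G_2)\bigr).$$ Take $G_1=G_2=G$. For each graph $G$ below, the Liapunov number of the system at the origin and $\sigma_B$ are both equal to the stated value (with $d(0)=d'(0)=d''(0)=0$):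 a) if $G$ is the complete graph $K_n$, or the wheel $W_n$ of order $n$ (a cycle on $n-1$ vertices together with one further vertex adjacent to all of them), with $n\ge4$, the value is $0$; b) if $G$ is the cycle $C_n$ with $n\ge4$, the value is $\frac{3n\pi}{2}$; c) if $G$ is the star $S_n$ of order $n$ (one vertex joined to each of the $n-1$ others, and no other edges), the value is $3\pi$ for $n=2$, $\frac{21\pi}{2}$ for $n=3$, and $\frac{3(n-1)(n-2)\pi}{4}$ for $n\ge4$. -/

import Mathlib

open Set Filter Topology

namespace BoundaryHopf

section Graphs

/-- The boundary `B(S)` of a set of vertices `S`: the vertices outside `S` that are adjacent to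
some vertex of `S`. -/
def boundary {V : Type*} [Fintype V] [DecidableEq V] (G : SimpleGraph V) [DecidableRel G.Adj]
    (S : Finset V) : Finset V :=
  Finset.univ.filter fun v => v ∉ S ∧ ∃ u ∈ S, G.Adj u v

/-- The boundary polynomial `B(G; x, y) = ∑_{S ⊆ V(G)} x^|B(S)| y^|S|`. -/
def boundaryPoly {V : Type*} [Fintype V] [DecidableEq V] (G : SimpleGraph V)
    [DecidableRel G.Adj] (x y : ℝ) : ℝ :=
  ∑ S : Finset V, x ^ (boundary G S).card * y ^ S.card

/-- The coefficient `B_{i,j}(G)`: the number of vertex subsets `S` with `|B(S)| = i`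
and `|S| = j`. -/
def boundaryCoeff {V : Type*} [Fintype V] [DecidableEq V] (G : SimpleGraph V)
    [DecidableRel G.Adj] (i j : ℕ) : ℕ :=
  (Finset.univ.filter fun S : Finset V => (boundary G S).card = i ∧ S.card = j).card

/-- The wheel graph `W_n` (meant for `4 ≤ n`): a cycle on `n - 1` vertices `some i`, and a hub
`none` adjacent to every vertex of the cycle. -/
def wheelGraph (n : ℕ) : SimpleGraph (Option (Fin (n - 1))) where
  Adj
    | none, none => False
    | none, some _ => True
    | some _, none => True
    | some i, some j => (SimpleGraph.cycleGraph (n - 1)).Adj i j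
  symm := ⟨fun a b h => by
    cases a <;> cases b <;> first | exact h | exact SimpleGraph.Adj.symm h⟩
  loopless := ⟨fun a h => by
    cases a
    · exact h
    · exact SimpleGraph.irrefl _ h⟩

instance (n : ℕ) : DecidableRel (wheelGraph n).Adj := fun a b =>
  match a, b with
  | none, none => inferInstanceAs (Decidable False)
  | none, some _ => inferInstanceAs (Decidable True)
  | some _, none => inferInstanceAs (Decidable True)
  | some i, some j => inferInstanceAs (Decidable ((SimpleGraph.cycleGraph (n - 1)).Adj i j))

end Graphs

section Dynamics

/-- The planar vector field
`x' = α x - y + B(G₁; x, y) - 1`, `y' = x + α y + B(G₂; x, y) - 1`. -/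
def hopfField {V₁ V₂ : Type*} [Fintype V₁] [DecidableEq V₁] [Fintype V₂] [DecidableEq V₂]
    (α : ℝ) (G₁ : SimpleGraph V₁) [DecidableRel G₁.Adj] (G₂ : SimpleGraph V₂)
    [DecidableRel G₂.Adj] (z : ℝ × ℝ) : ℝ × ℝ :=
  (α * z.1 - z.2 + boundaryPoly G₁ z.1 z.2 - 1, z.1 + α * z.2 + boundaryPoly G₂ z.1 z.2 - 1)

/-- `p` is the value at `s` of the Poincaré map of the focus at the origin of `z' = F z`: the
solution starting from `(s, 0)`, written in polar coordinates `(r, θ)` with `θ = 0` at time `0`,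
has radius `p` at the first time `T` at which the polar angle equals `2π`. -/
def IsFirstReturn (F : ℝ × ℝ → ℝ × ℝ) (s p : ℝ) : Prop :=
  ∃ T : ℝ, 0 < T ∧ ∃ r θ : ℝ → ℝ,
    ContinuousOn r (Icc 0 T) ∧ ContinuousOn θ (Icc 0 T) ∧
    (∀ t ∈ Icc 0 T, 0 < r t) ∧
    (∀ t ∈ Icc 0 T,
      HasDerivWithinAt (fun τ => (r τ * Real.cos (θ τ), r τ * Real.sin (θ τ)))
        (F (r t * Real.cos (θ t), r t * Real.sin (θ t))) (Icc 0 T) t) ∧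
    r 0 = s ∧ θ 0 = 0 ∧
    (∀ t ∈ Ico 0 T, θ t < 2 * Real.pi) ∧ θ T = 2 * Real.pi ∧ r T = p

/-- `σ` is the Liapunov number of the focus at the origin of `z' = F z` (with linear part
`x' = -y`, `y' = x` at the origin): the Poincaré map `P` is defined for all small `s > 0`, and
its displacement function `d(s) = P(s) - s` satisfies `d(s) = (σ / 6) s³ + o(s³)` as `s → 0⁺`.
For an analytic vector field `d` extends analytically to a neighbourhood of `0`, and this says
exactly that `d(0) = d'(0) = d''(0) = 0` and `d'''(0) = σ`. -/
def IsLiapunovNumber (F : ℝ × ℝ → ℝ × ℝ) (σ : ℝ) : Prop :=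
  ∃ P : ℝ → ℝ, (∀ᶠ s in 𝓝[>] (0 : ℝ), IsFirstReturn F s (P s)) ∧
    Tendsto (fun s => (P s - s) / s ^ 3) (𝓝[>] (0 : ℝ)) (𝓝 (σ / 6))

/-- The quantity `σ_B` attached to the pair `(G₁, G₂)` through the coefficients of the boundary
polynomials. -/
noncomputable def sigmaB {V₁ V₂ : Type*} [Fintype V₁] [DecidableEq V₁] [Fintype V₂]
    [DecidableEq V₂] (G₁ : SimpleGraph V₁) [DecidableRel G₁.Adj] (G₂ : SimpleGraph V₂)
    [DecidableRel G₂.Adj] : ℝ :=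
  3 * Real.pi / 2 *
    (3 * (boundaryCoeff G₂ 0 3 : ℝ) + (boundaryCoeff G₁ 1 2 : ℝ) + (boundaryCoeff G₂ 2 1 : ℝ)
      + 2 * (boundaryCoeff G₁ 0 2 : ℝ) * (boundaryCoeff G₂ 0 2 : ℝ)
      + (boundaryCoeff G₁ 1 1 : ℝ) * (boundaryCoeff G₁ 0 2 : ℝ)
      - (boundaryCoeff G₂ 1 1 : ℝ) * (boundaryCoeff G₂ 0 2 : ℝ))

/-- `σ_B` of the pair `(G₁, G₂)` has the value `v`: `v` is the Liapunov number at the origin of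
the system with `α = 0`, and the expression in the boundary coefficients has this value as well. -/
def SigmaBEq {V₁ V₂ : Type*} [Fintype V₁] [DecidableEq V₁] [Fintype V₂] [DecidableEq V₂]
    (G₁ : SimpleGraph V₁) [DecidableRel G₁.Adj] (G₂ : SimpleGraph V₂) [DecidableRel G₂.Adj]
    (v : ℝ) : Prop :=
  IsLiapunovNumber (hopfField 0 G₁ G₂) v ∧ sigmaB G₁ G₂ = v

end Dynamics

end BoundaryHopf

/-! A quartic polynomial `V = (x² + y²)/2 + …` is chosen so that its derivative along the field is
`L r⁴ + O(r⁵)`. The orbit of `(s, 0)` stays within `O(s²)` of the circle of radius `s`, and one turn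
takes time `2π + O(s)`, so `V` grows by `2πL s⁴ + O(s⁵)`. Since `V(P, 0) - V(s, 0)` is asymptotic to
`s (P - s)`, this gives `P - s ~ 2πL s³` and the Liapunov number `12πL`
(`isLiapunovNumber_of_energy`). Solving for the coefficients of `V` gives `L` in terms of the 3-jet
(`isLiapunovNumber_of_jet`).

Without isolated vertices `B_{0,1} = 0`, and `B_{i,0} = 0` for `i > 0`, so the 3-jet has the
required form and the Liapunov number is `σ_B` (`isLiapunovNumber_hopfField`). For `G₁ = G₂` this
leaves `3 B_{0,3} + B_{1,2} + B_{2,1} + 2 B_{0,2}²`. In a connected graph of order at least 4 only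
`B_{1,2} + B_{2,1}` survives, and it is counted family by family; the two small stars are computed
directly. -/

namespace BoundaryHopf

/-! ### Existence of the first return near the focus -/

section FirstReturn

open Complex

/-- Picard–Lindelöf with the additional information that the solution stays in the ball. -/
theorem exists_hasDerivWithinAt_mem_closedBall {E : Type*} [NormedAddCommGroup E]
    [NormedSpace ℝ E] [CompleteSpace E] {f : ℝ → E → E} {tmin tmax : ℝ} {t₀ : Icc tmin tmax}
    {x₀ : E} {a L K : NNReal} (hf : IsPicardLindelof f t₀ x₀ a 0 L K) :
    ∃ α : ℝ → E, α t₀ = x₀ ∧ ∀ t ∈ Icc tmin tmax, α t ∈ Metric.closedBall x₀ a ∧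
      HasDerivWithinAt α (f t (α t)) (Icc tmin tmax) t := by
  obtain ⟨α, hα⟩ := ODE.FunSpace.exists_isFixedPt_next hf (Metric.mem_closedBall_self le_rfl)
  have hfix : ∀ t ∈ Icc tmin tmax, α.compProj t = ODE.picard f t₀ x₀ α.compProj t := by
    intro t ht
    conv_lhs => rw [← hα]
    rw [ODE.FunSpace.compProj_apply, ODE.FunSpace.next_apply, projIcc_of_mem _ ht]
  have hmem : ∀ t, α.compProj t ∈ Metric.closedBall x₀ a := fun t =>
    α.compProj_mem_closedBall hf.mul_max_le
  refine ⟨α.compProj, ?_, fun t ht => ⟨hmem t, ?_⟩⟩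
  · rw [hfix _ t₀.2]; simp
  · exact (ODE.hasDerivWithinAt_picard_Icc t₀.2 hf.continuousOn_uncurry
      α.continuous_compProj.continuousOn (fun t _ => hmem t) x₀ ht).congr_of_mem hfix ht

/-- In the frame rotating with unit angular speed and scaled by `s`, the solution of
`z' = I z + h z` starting from `s` stays `O(s)`-close to `1` on `[0, 8]`. -/
theorem exists_rotating_solution {h : ℂ → ℂ} (hd : ContDiff ℝ 1 h)
    (hO : h =O[𝓝 0] fun z => ‖z‖ ^ 2) :
    ∃ C : ℝ, 0 < C ∧ ∀ᶠ s : ℝ in 𝓝[>] 0, ∃ w : ℝ → ℂ, w 0 = 1 ∧ ∀ t ∈ Icc (0 : ℝ) 8,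
      ‖w t - 1‖ ≤ C * s ∧
      HasDerivWithinAt w ((s : ℂ)⁻¹ * exp (-(t * I)) * h (s * exp (t * I) * w t))
        (Icc 0 8) t := by
  obtain ⟨C, hC0, hC⟩ := hO.exists_pos
  rw [Asymptotics.isBigOWith_iff, Metric.eventually_nhds_iff] at hC
  obtain ⟨δ, hδ, hC⟩ := hC
  obtain ⟨K, hK⟩ := LocallyLipschitzOn.exists_lipschitzOnWith_of_compact
    (isCompact_closedBall (0 : ℂ) 2) (hd.locallyLipschitz.locallyLipschitzOn)
  refine ⟨32 * C, by positivity, ?_⟩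
  have hpos : (0 : ℝ) < min (min (δ / 2) (1 / (32 * C))) 1 := by positivity
  filter_upwards [Ioo_mem_nhdsGT hpos] with s hs
  obtain ⟨hs0, hs1⟩ := hs
  have hsδ : s < δ / 2 := hs1.trans_le ((min_le_left _ _).trans (min_le_left _ _))
  have hsC : s < 1 / (32 * C) := hs1.trans_le ((min_le_left _ _).trans (min_le_right _ _))
  have hs1 : s < 1 := hs1.trans_le (min_le_right _ _)
  have hCs : 32 * C * s ≤ 1 := by
    rw [lt_div_iff₀ (by positivity)] at hsC; linarith
  have hCs0 : 0 ≤ 32 * C * s := by positivity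
  have hLs0 : 0 ≤ 4 * C * s := by positivity
  have hball : ∀ w ∈ Metric.closedBall (1 : ℂ) (32 * C * s), ‖w‖ ≤ 2 := by
    intro w hw
    rw [Metric.mem_closedBall, dist_eq_norm] at hw
    calc ‖w‖ = ‖(w - 1) + 1‖ := by simp
      _ ≤ ‖w - 1‖ + ‖(1 : ℂ)‖ := norm_add_le _ _
      _ ≤ 2 := by rw [norm_one]; linarith
  have hn : ∀ (t : ℝ) (w : ℂ), ‖(s : ℂ) * exp (t * I) * w‖ = s * ‖w‖ := by
    intro t w
    rw [norm_mul, norm_mul, norm_exp_ofReal_mul_I, norm_real, Real.norm_of_nonneg hs0.le, mul_one]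
  have hn' : ∀ (t : ℝ) (w : ℂ), ‖(s : ℂ)⁻¹ * exp (-(t * I)) * w‖ = s⁻¹ * ‖w‖ := by
    intro t w
    have := norm_exp_ofReal_mul_I (-t)
    rw [norm_mul, norm_mul, norm_inv, norm_real, Real.norm_of_nonneg hs0.le]
    rw [ofReal_neg, neg_mul] at this
    rw [this, mul_one]
  have hPL : IsPicardLindelof
      (fun (t : ℝ) (w : ℂ) => (s : ℂ)⁻¹ * exp (-(t * I)) * h (s * exp (t * I) * w))
      (⟨0, by norm_num⟩ : Icc (0 : ℝ) 8) (1 : ℂ) ⟨32 * C * s, hCs0⟩ 0 ⟨4 * C * s, hLs0⟩ K := by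
    refine ⟨fun t _ => LipschitzOnWith.of_dist_le_mul fun x hx y hy => ?_, fun x _ => ?_,
      fun t _ x hx => ?_, ?_⟩
    · have hx' := hball x hx
      have hy' := hball y hy
      rw [dist_eq_norm, ← mul_sub, hn', ← dist_eq_norm]
      have := hK.dist_le_mul (s * exp (t * I) * x)
        (by rw [mem_closedBall_zero_iff, hn]; nlinarith [norm_nonneg x]) (s * exp (t * I) * y)
        (by rw [mem_closedBall_zero_iff, hn]; nlinarith [norm_nonneg y])
      rw [dist_eq_norm (_ * x), ← mul_sub, hn, ← dist_eq_norm] at this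
      -- The two scalings by `s` cancel, so the Lipschitz constant does not depend on `s`.
      calc s⁻¹ * dist _ _ ≤ s⁻¹ * (K * (s * dist x y)) := by gcongr
        _ = K * dist x y := by field_simp
    · have := hd.continuous
      fun_prop
    · have hx' := hball x hx
      rw [hn']
      have h1 := hC (y := s * exp (t * I) * x) (by
        rw [dist_zero_right, hn]; nlinarith [norm_nonneg x])
      rw [hn, norm_pow, Real.norm_of_nonneg (by positivity)] at h1
      have h2 : ‖x‖ ^ 2 ≤ 4 := by nlinarith [norm_nonneg x]
      calc s⁻¹ * ‖h _‖ ≤ s⁻¹ * (C * (s * ‖x‖) ^ 2) := by gcongr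
        _ = C * s * ‖x‖ ^ 2 := by field_simp
        _ ≤ C * s * 4 := by gcongr
        _ = 4 * C * s := by ring
    · change 4 * C * s * max (8 - 0) (0 - 0) ≤ 32 * C * s - 0
      norm_num
      linarith
  obtain ⟨w, hw0, hw⟩ := exists_hasDerivWithinAt_mem_closedBall hPL
  refine ⟨w, hw0, fun t ht => ⟨?_, (hw t ht).2⟩⟩
  have := (hw t ht).1
  rwa [Metric.mem_closedBall, dist_eq_norm] at this

/-- A planar curve given in the rotating frame by `w`, with `w` close to `1`, makes a first full
turn at some time in `[0, 8]`. -/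
theorem exists_isFirstReturn {F : ℝ × ℝ → ℝ × ℝ} {s : ℝ} (hs : 0 < s) {w : ℝ → ℂ} (hw0 : w 0 = 1)
    (hw : ∀ t ∈ Icc (0 : ℝ) 8, ‖w t - 1‖ < 1)
    (hwc : ContinuousOn w (Icc 0 8))
    (hz : ∀ t ∈ Icc (0 : ℝ) 8, HasDerivWithinAt
      (fun τ : ℝ => ((s * exp (τ * I) * w τ).re, (s * exp (τ * I) * w τ).im))
      (F ((s * exp (t * I) * w t).re, (s * exp (t * I) * w t).im)) (Icc 0 8) t) :
    ∃ T ∈ Icc (0 : ℝ) 8, T + arg (w T) = 2 * Real.pi ∧ IsFirstReturn F s (s * ‖w T‖) := by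
  -- In the right half-plane `arg` is continuous with values in `(-π/2, π/2)`. Hence `t + arg (w t)`
  -- is a continuous polar angle of the orbit, and it exceeds `2π` at `t = 8` because `5π/2 < 8`.
  have hre : ∀ t ∈ Icc (0 : ℝ) 8, 0 < (w t).re := by
    intro t ht
    have h1 := (abs_re_le_norm (w t - 1)).trans_lt (hw t ht)
    rw [sub_re, one_re, abs_lt] at h1
    linarith [h1.1]
  have harg : ∀ t ∈ Icc (0 : ℝ) 8, |arg (w t)| < Real.pi / 2 := fun t ht =>
    abs_arg_lt_pi_div_two_iff.2 (Or.inl (hre t ht))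
  have hpolar : ∀ t : ℝ, (s : ℂ) * exp (t * I) * w t =
      ((s * ‖w t‖ : ℝ) : ℂ) * exp ((t + arg (w t) : ℝ) * I) := by
    intro t
    conv_lhs => rw [← norm_mul_exp_arg_mul_I (w t)]
    push_cast
    rw [add_mul, exp_add]
    ring
  have hpre : ∀ t : ℝ, ((s : ℂ) * exp (t * I) * w t).re =
      s * ‖w t‖ * Real.cos (t + arg (w t)) := by
    intro t
    rw [hpolar, re_ofReal_mul, exp_ofReal_mul_I_re]
  have hpim : ∀ t : ℝ, ((s : ℂ) * exp (t * I) * w t).im =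
      s * ‖w t‖ * Real.sin (t + arg (w t)) := by
    intro t
    rw [hpolar, im_ofReal_mul, exp_ofReal_mul_I_im]
  have hθc : ContinuousOn (fun t : ℝ => t + arg (w t)) (Icc 0 8) := by
    refine continuousOn_id.add fun t ht => ?_
    exact (continuousAt_arg (Or.inl (hre t ht))).comp_continuousWithinAt (hwc t ht)
  have h8 : (8 : ℝ) ∈ Icc (0 : ℝ) 8 := by norm_num
  have h0 : (0 : ℝ) ∈ Icc (0 : ℝ) 8 := by norm_num
  have hπ := Real.pi_lt_d2
  have hπ0 := Real.pi_pos
  have hcl : IsClosed {t ∈ Icc (0 : ℝ) 8 | 2 * Real.pi ≤ t + arg (w t)} :=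
    isClosed_Icc.isClosed_le continuousOn_const hθc
  have hcpt : IsCompact {t ∈ Icc (0 : ℝ) 8 | 2 * Real.pi ≤ t + arg (w t)} :=
    isCompact_Icc.of_isClosed_subset hcl (sep_subset _ _)
  obtain ⟨T, ⟨hT, hTge⟩, hTmin⟩ := hcpt.exists_isLeast ⟨8, h8, by
    have := (abs_lt.1 (harg 8 h8)).1
    linarith⟩
  have hθ0 : (0 : ℝ) + arg (w 0) = 0 := by simp [hw0]
  have hT0 : 0 < T := by
    rcases hT.1.eq_or_lt with h | h
    · rw [← h, hθ0] at hTge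
      linarith
    · exact h
  have hlt : ∀ t ∈ Ico 0 T, t + arg (w t) < 2 * Real.pi := by
    intro t ht
    by_contra hcon
    exact absurd (hTmin ⟨⟨ht.1, ht.2.le.trans hT.2⟩, not_lt.1 hcon⟩) (not_le.2 ht.2)
  have hTle : T + arg (w T) ≤ 2 * Real.pi := by
    have hcont : ContinuousOn (fun t : ℝ => t + arg (w t)) (Icc 0 T) :=
      hθc.mono (Icc_subset_Icc_right hT.2)
    obtain ⟨t, ht, hte⟩ := intermediate_value_Icc hT.1 hcont
      (show 2 * Real.pi ∈ Icc _ _ from ⟨by simp only [hθ0]; positivity, hTge⟩)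
    rcases ht.2.eq_or_lt with h | h
    · rw [← h]; exact hte.le
    · exact absurd hte (hlt t ⟨ht.1, h⟩).ne
  have hTeq : T + arg (w T) = 2 * Real.pi := le_antisymm hTle hTge
  have hsub : Icc (0 : ℝ) T ⊆ Icc 0 8 := Icc_subset_Icc_right hT.2
  refine ⟨T, hT, hTeq, T, hT0, fun t => s * ‖w t‖, fun t => t + arg (w t), ?_, hθc.mono hsub,
    fun t ht => ?_, fun t ht => ?_, ?_, hθ0, hlt, hTeq, rfl⟩
  · exact (continuousOn_const.mul hwc.norm).mono hsub
  · have : w t ≠ 0 := fun h => by have := hre t (hsub ht); rw [h] at this; simp at this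
    positivity
  · have := (hz t (hsub ht)).mono hsub
    simpa only [hpre, hpim] using this
  · simp [hw0]

end FirstReturn

/-! ### Liapunov number from an energy function -/

section Liapunov

open Complex

/-- Along the first turn of the orbit starting from `(s, 0)`, a function `V` whose derivative
along the field is `L r⁴ + O(r⁵)` increases by `L s⁴` times the return time, up to `O(s⁵)`. -/
theorem exists_isFirstReturn_energy {F : ℝ × ℝ → ℝ × ℝ} (hF : ContDiff ℝ 1 F)
    (hlin : (fun p : ℝ × ℝ => F p - (-p.2, p.1)) =O[𝓝 0] fun p => ‖p‖ ^ 2)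
    {V : ℝ × ℝ → ℝ} {V' : ℝ × ℝ → ℝ × ℝ →L[ℝ] ℝ} (hV : ∀ p, HasFDerivAt V (V' p) p) {L : ℝ}
    (hVF : (fun p : ℝ × ℝ => V' p (F p) - L * (p.1 ^ 2 + p.2 ^ 2) ^ 2) =O[𝓝 0]
      fun p => ‖p‖ ^ 5) :
    ∃ D : ℝ, ∀ᶠ s : ℝ in 𝓝[>] 0, ∃ ω : ℂ, IsFirstReturn F s (s * ‖ω‖) ∧ ‖ω - 1‖ ≤ D * s ∧
      |V (s * ‖ω‖, 0) - V (s, 0) - L * s ^ 4 * (2 * Real.pi - arg ω)| ≤ D * s ^ 5 := by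
  let h : ℂ → ℂ := fun z =>
    equivRealProdCLM.symm (F (equivRealProdCLM z) -
      (-(equivRealProdCLM z).2, (equivRealProdCLM z).1))
  have hd : ContDiff ℝ 1 h := by
    refine equivRealProdCLM.symm.contDiff.comp ((hF.comp equivRealProdCLM.contDiff).sub ?_)
    exact (equivRealProdCLM.contDiff.snd.neg).prodMk equivRealProdCLM.contDiff.fst
  have hO : h =O[𝓝 0] fun z => ‖z‖ ^ 2 := by
    have ht : Tendsto equivRealProdCLM (𝓝 0) (𝓝 0) := by
      have := equivRealProdCLM.continuous.tendsto 0
      rwa [map_zero] at this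
    refine (equivRealProdCLM.symm.isBigO_comp _ _).trans ((hlin.comp_tendsto ht).trans ?_)
    exact (((equivRealProdCLM : ℂ →L[ℝ] ℝ × ℝ).isBigO_id _).norm_norm).pow 2
  obtain ⟨C, hC0, hC⟩ := exists_rotating_solution hd hO
  obtain ⟨C₂, hC₂0, hC₂⟩ := hVF.exists_pos
  rw [Asymptotics.isBigOWith_iff, Metric.eventually_nhds_iff] at hC₂
  obtain ⟨δ, hδ, hC₂⟩ := hC₂
  -- `32 = 2⁵` comes from `‖p t‖ ≤ 2 s`, `15 = 3 * 5` bounds `(‖w‖ + 1)(‖w‖² + 1)` for `‖w‖ ≤ 2`,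
  -- and 8 bounds the return time.
  refine ⟨max C (8 * (32 * C₂ + 15 * |L| * C)), ?_⟩
  have hpos : (0 : ℝ) < min (δ / 2) (1 / (2 * C)) := by positivity
  filter_upwards [hC, Ioo_mem_nhdsGT hpos] with s ⟨w, hw0, hw⟩ hs
  obtain ⟨hs0, hs1⟩ := hs
  have hsδ : s < δ / 2 := hs1.trans_le (min_le_left _ _)
  have hsC : C * s < 1 / 2 := by
    have := hs1.trans_le (min_le_right _ _)
    rw [lt_div_iff₀ (by positivity)] at this
    linarith
  have hnz : ∀ t : ℝ, ‖(s : ℂ) * exp (t * I) * w t‖ = s * ‖w t‖ := by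
    intro t
    rw [norm_mul, norm_mul, norm_exp_ofReal_mul_I, norm_real, Real.norm_of_nonneg hs0.le, mul_one]
  let p : ℝ → ℝ × ℝ := fun t =>
    (((s : ℂ) * exp (t * I) * w t).re, ((s : ℂ) * exp (t * I) * w t).im)
  have hp : ∀ t ∈ Icc (0 : ℝ) 8, HasDerivWithinAt p (F (p t)) (Icc 0 8) t := by
    intro t ht
    have he : HasDerivWithinAt (fun τ : ℝ => (s : ℂ) * exp (τ * I))
        ((s : ℂ) * (exp (t * I) * I)) (Icc 0 8) t := by
      have h1 : HasDerivAt (fun τ : ℝ => (τ : ℂ) * I) I t := by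
        simpa using (hasDerivAt_id t).ofReal_comp.mul_const I
      exact (h1.cexp.const_mul _).hasDerivWithinAt
    have hz := he.mul (hw t ht).2
    have hval : (s : ℂ) * (exp (t * I) * I) * w t + (s : ℂ) * exp (t * I) *
        ((s : ℂ)⁻¹ * exp (-(t * I)) * h (s * exp (t * I) * w t)) =
        equivRealProdCLM.symm (F (p t)) := by
      have hs' : (s : ℂ) ≠ 0 := by exact_mod_cast hs0.ne'
      have hee : exp (t * I) * exp (-(t * I)) = 1 := by rw [← exp_add]; simp
      have h2 : (s : ℂ) * exp (t * I) *
          ((s : ℂ)⁻¹ * exp (-(t * I)) * h (s * exp (t * I) * w t)) =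
          h (s * exp (t * I) * w t) := by
        calc _ = ((s : ℂ) * (s : ℂ)⁻¹) * (exp (t * I) * exp (-(t * I))) *
              h (s * exp (t * I) * w t) := by ring
          _ = _ := by rw [hee, mul_inv_cancel₀ hs', one_mul, one_mul]
      rw [h2]
      have h3 : ∀ z : ℂ, I * z + h z = equivRealProdCLM.symm (F (z.re, z.im)) := by
        intro z
        apply Complex.ext <;> simp [h]
      rw [← h3 ((s : ℂ) * exp (t * I) * w t)]
      ring
    rw [hval] at hz
    have := (equivRealProdCLM : ℂ →L[ℝ] ℝ × ℝ).hasFDerivAt.comp_hasDerivWithinAt t hz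
    rwa [ContinuousLinearEquiv.coe_coe, ContinuousLinearEquiv.apply_symm_apply] at this
  have hw1 : ∀ t ∈ Icc (0 : ℝ) 8, ‖w t - 1‖ < 1 := fun t ht => by
    linarith [(hw t ht).1]
  have hwc : ContinuousOn w (Icc 0 8) := fun t ht => (hw t ht).2.continuousWithinAt
  obtain ⟨T, hT, hTa, hret⟩ := exists_isFirstReturn hs0 hw0 hw1 hwc hp
  refine ⟨w T, hret, (hw T hT).1.trans (by gcongr; exact le_max_left _ _), ?_⟩
  -- After the main growth `L s⁴ t` is subtracted, the derivative is `O(s⁵)` and the mean value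
  -- inequality applies.
  have hder : ∀ t ∈ Icc (0 : ℝ) 8, HasDerivWithinAt (fun τ => V (p τ) - L * s ^ 4 * τ)
      (V' (p t) (F (p t)) - L * s ^ 4) (Icc 0 8) t := by
    intro t ht
    have := ((hV (p t)).comp_hasDerivWithinAt t (hp t ht)).sub
      ((hasDerivWithinAt_id t (Icc 0 8)).const_mul (L * s ^ 4))
    rwa [mul_one] at this
  have hbound : ∀ t ∈ Ico (0 : ℝ) 8, ‖V' (p t) (F (p t)) - L * s ^ 4‖ ≤
      (32 * C₂ + 15 * |L| * C) * s ^ 5 := by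
    intro t ht
    have hwt := (hw t (Ico_subset_Icc_self ht)).1
    have hn1 : |‖w t‖ - 1| ≤ C * s := by
      have := abs_norm_sub_norm_le (w t) 1
      rw [norm_one] at this
      exact this.trans hwt
    have hn2 : ‖w t‖ ≤ 2 := by linarith [(abs_le.1 hn1).2]
    have hnp : ‖p t‖ ≤ 2 * s := by
      refine (max_le (abs_re_le_norm _) (abs_im_le_norm _)).trans ?_
      rw [hnz]
      nlinarith
    have h1 := hC₂ (y := p t) (by rw [dist_zero_right]; linarith)
    have h2 : (p t).1 ^ 2 + (p t).2 ^ 2 = (s * ‖w t‖) ^ 2 := by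
      rw [← hnz, Complex.sq_norm, normSq_apply]
      ring
    rw [h2, norm_pow, norm_norm] at h1
    have h3 : V' (p t) (F (p t)) - L * s ^ 4 =
        (V' (p t) (F (p t)) - L * ((s * ‖w t‖) ^ 2) ^ 2) +
          L * s ^ 4 * ((‖w t‖ - 1) * ((‖w t‖ + 1) * (‖w t‖ ^ 2 + 1))) := by ring
    have h4 : (‖w t‖ + 1) * (‖w t‖ ^ 2 + 1) ≤ 3 * 5 := by
      gcongr
      · linarith
      · nlinarith [norm_nonneg (w t)]
    rw [h3]
    refine (norm_add_le _ _).trans ?_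
    have h5 : ‖L * s ^ 4 * ((‖w t‖ - 1) * ((‖w t‖ + 1) * (‖w t‖ ^ 2 + 1)))‖ ≤
        |L| * s ^ 4 * (C * s * (3 * 5)) := by
      rw [Real.norm_eq_abs, abs_mul, abs_mul, abs_mul, abs_of_pos (pow_pos hs0 4),
        abs_of_nonneg (a := (‖w t‖ + 1) * (‖w t‖ ^ 2 + 1)) (by positivity)]
      gcongr
    have h6 : C₂ * ‖p t‖ ^ 5 ≤ C₂ * (2 * s) ^ 5 := by gcongr
    calc _ ≤ C₂ * (2 * s) ^ 5 + |L| * s ^ 4 * (C * s * (3 * 5)) := by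
          gcongr
          exact h1.trans h6
      _ = _ := by ring
  have hfin := norm_image_sub_le_of_norm_deriv_le_segment' hder hbound T hT
  have hp0 : p 0 = (s, 0) := by simp [p, hw0]
  have hpT : p T = (s * ‖w T‖, 0) := by
    have : (s : ℂ) * exp (T * I) * w T = ((s * ‖w T‖ : ℝ) : ℂ) := by
      conv_lhs => rw [← norm_mul_exp_arg_mul_I (w T)]
      have h1 : exp (T * I) * exp (arg (w T) * I) = 1 := by
        rw [← exp_add, ← add_mul, ← ofReal_add, hTa]
        push_cast
        exact exp_two_pi_mul_I
      push_cast
      linear_combination (s : ℂ) * ‖w T‖ * h1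
    simp only [p, this, ofReal_re, ofReal_im]
  rw [hp0, hpT, Real.norm_eq_abs] at hfin
  have hT2 : 2 * Real.pi - arg (w T) = T := by linarith
  rw [hT2]
  have hM : 0 ≤ (32 * C₂ + 15 * |L| * C) * s ^ 5 := by positivity
  calc |V (s * ‖w T‖, 0) - V (s, 0) - L * s ^ 4 * T|
      = |V (s * ‖w T‖, 0) - L * s ^ 4 * T - (V (s, 0) - L * s ^ 4 * 0)| := by
        congr 1; ring
    _ ≤ (32 * C₂ + 15 * |L| * C) * s ^ 5 * (T - 0) := hfin
    _ ≤ (32 * C₂ + 15 * |L| * C) * s ^ 5 * 8 := by gcongr; linarith [hT.2]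
    _ = 8 * (32 * C₂ + 15 * |L| * C) * s ^ 5 := by ring
    _ ≤ _ := by gcongr; exact le_max_right _ _

/-- A Lyapunov function `V = x² / 2 + …` with derivative `L r⁴ + O(r⁵)` along the field shows that
the Liapunov number is `12 π L`. -/
theorem isLiapunovNumber_of_energy {F : ℝ × ℝ → ℝ × ℝ} (hF : ContDiff ℝ 1 F)
    (hlin : (fun p : ℝ × ℝ => F p - (-p.2, p.1)) =O[𝓝 0] fun p => ‖p‖ ^ 2)
    {V : ℝ × ℝ → ℝ} {V' : ℝ × ℝ → ℝ × ℝ →L[ℝ] ℝ} (hV : ∀ p, HasFDerivAt V (V' p) p) {L : ℝ}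
    (hVF : (fun p : ℝ × ℝ => V' p (F p) - L * (p.1 ^ 2 + p.2 ^ 2) ^ 2) =O[𝓝 0]
      fun p => ‖p‖ ^ 5)
    {A B : ℝ} (hVx : ∀ x, V (x, 0) = x ^ 2 / 2 + A * x ^ 3 + B * x ^ 4) :
    IsLiapunovNumber F (12 * Real.pi * L) := by
  obtain ⟨D, hD⟩ := exists_isFirstReturn_energy hF hlin hV hVF
  obtain ⟨ω, hω⟩ := hD.choice
  refine ⟨fun s => s * ‖ω s‖, hω.mono fun s hs => hs.1, ?_⟩
  have hid : Tendsto (fun s : ℝ => s) (𝓝[>] 0) (𝓝 0) := tendsto_nhdsWithin_of_tendsto_nhds tendsto_id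
  have hDs : Tendsto (fun s : ℝ => D * s) (𝓝[>] 0) (𝓝 0) := by
    simpa using hid.const_mul D
  have hω1 : Tendsto ω (𝓝[>] 0) (𝓝 1) := by
    rw [tendsto_iff_norm_sub_tendsto_zero]
    exact squeeze_zero' (Eventually.of_forall fun s => norm_nonneg _)
      (hω.mono fun s hs => hs.2.1) hDs
  have hu : Tendsto (fun s => ‖ω s‖) (𝓝[>] 0) (𝓝 1) := by simpa using hω1.norm
  have harg : Tendsto (fun s => arg (ω s)) (𝓝[>] 0) (𝓝 0) := by
    have := (continuousAt_arg (x := 1) (by simp)).tendsto.comp hω1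
    simpa [Function.comp_def] using this
  -- The cofactor in `V (s‖ω‖, 0) - V (s, 0) = s² (‖ω‖ - 1) κ`; since `κ → 1`, the limit of `ΔV /
  -- s⁴` is that of `(P - s) / s³`.
  let κ : ℝ → ℝ := fun s => (‖ω s‖ + 1) / 2 + A * s * (‖ω s‖ ^ 2 + ‖ω s‖ + 1) +
    B * s ^ 2 * (‖ω s‖ ^ 3 + ‖ω s‖ ^ 2 + ‖ω s‖ + 1)
  have hκ : Tendsto κ (𝓝[>] 0) (𝓝 1) := by
    have := (((hu.add_const 1).div_const 2).add
      ((hid.const_mul A).mul (((hu.pow 2).add hu).add_const 1))).add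
      (((hid.pow 2).const_mul B).mul ((((hu.pow 3).add (hu.pow 2)).add hu).add_const 1))
    convert this using 2
    norm_num
  have hΔ : Tendsto (fun s => (V (s * ‖ω s‖, 0) - V (s, 0)) / s ^ 4) (𝓝[>] 0)
      (𝓝 (L * (2 * Real.pi))) := by
    have h1 : Tendsto (fun s => L * (2 * Real.pi - arg (ω s))) (𝓝[>] 0)
        (𝓝 (L * (2 * Real.pi))) := by
      simpa using (tendsto_const_nhds.sub harg).const_mul L
    have h2 : Tendsto (fun s => (V (s * ‖ω s‖, 0) - V (s, 0)) / s ^ 4 -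
        L * (2 * Real.pi - arg (ω s))) (𝓝[>] 0) (𝓝 0) := by
      refine squeeze_zero_norm' ?_ hDs
      filter_upwards [hω, self_mem_nhdsWithin] with s hs hs0
      have hs0 : 0 < s := hs0
      have : (V (s * ‖ω s‖, 0) - V (s, 0)) / s ^ 4 - L * (2 * Real.pi - arg (ω s)) =
          (V (s * ‖ω s‖, 0) - V (s, 0) - L * s ^ 4 * (2 * Real.pi - arg (ω s))) / s ^ 4 := by
        field_simp
      rw [this, norm_div, Real.norm_eq_abs, Real.norm_of_nonneg (pow_nonneg hs0.le 4),
        div_le_iff₀ (pow_pos hs0 4)]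
      calc _ ≤ D * s ^ 5 := hs.2.2
        _ = D * s * s ^ 4 := by ring
    simpa using h2.add h1
  have hlim := hΔ.div hκ one_ne_zero
  have hval : L * (2 * Real.pi) / 1 = 12 * Real.pi * L / 6 := by ring
  rw [hval] at hlim
  refine hlim.congr' ?_
  filter_upwards [hκ.eventually_ne one_ne_zero, self_mem_nhdsWithin] with s hκs hs0
  have hs0 : s ≠ 0 := ne_of_gt hs0
  have : V (s * ‖ω s‖, 0) - V (s, 0) = s ^ 2 * (‖ω s‖ - 1) * κ s := by
    rw [hVx, hVx]
    simp only [κ]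
    ring
  simp only [Pi.div_apply]
  rw [this]
  field_simp

end Liapunov

/-! ### Liapunov number from the 3-jet -/

section Jet

open Asymptotics

theorem isBigO_norm_pow_of_le {E : Type*} [SeminormedAddCommGroup E] {m n : ℕ} (h : m ≤ n) :
    (fun p : E => ‖p‖ ^ n) =O[𝓝 0] fun p => ‖p‖ ^ m := by
  refine IsBigO.of_bound 1 ?_
  filter_upwards [Metric.ball_mem_nhds (0 : E) one_pos] with p hp
  rw [mem_ball_zero_iff] at hp
  rw [norm_pow, norm_pow, norm_norm, one_mul]
  exact pow_le_pow_of_le_one (norm_nonneg p) hp.le h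

theorem isBigO_monomial (c : ℝ) {i j n : ℕ} (h : n ≤ i + j) :
    (fun p : ℝ × ℝ => c * (p.1 ^ i * p.2 ^ j)) =O[𝓝 0] fun p => ‖p‖ ^ n := by
  refine IsBigO.trans (IsBigO.of_bound |c| (Eventually.of_forall fun p => ?_))
    (isBigO_norm_pow_of_le h)
  rw [norm_mul, norm_mul, norm_pow, norm_pow, norm_pow, norm_norm, pow_add, Real.norm_eq_abs]
  gcongr
  · exact norm_fst_le p
  · exact norm_snd_le p

/-- The Liapunov number of a planar field whose nonlinear part has no term divisible by a pure
power of `x`, in terms of the coefficients of its 3-jet. -/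
theorem isLiapunovNumber_of_jet {F : ℝ × ℝ → ℝ × ℝ} (hF : ContDiff ℝ 1 F)
    {a₁ a₂ a₃ a₄ a₅ b₁ b₂ b₃ b₄ b₅ : ℝ}
    (h₁ : (fun p : ℝ × ℝ => (F p).1 - (-p.2 + (a₁ * (p.1 * p.2) + a₂ * p.2 ^ 2) +
      (a₃ * (p.1 ^ 2 * p.2) + a₄ * (p.1 * p.2 ^ 2) + a₅ * p.2 ^ 3))) =O[𝓝 0] fun p => ‖p‖ ^ 4)
    (h₂ : (fun p : ℝ × ℝ => (F p).2 - (p.1 + (b₁ * (p.1 * p.2) + b₂ * p.2 ^ 2) +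
      (b₃ * (p.1 ^ 2 * p.2) + b₄ * (p.1 * p.2 ^ 2) + b₅ * p.2 ^ 3))) =O[𝓝 0] fun p => ‖p‖ ^ 4) :
    IsLiapunovNumber F
      (3 * Real.pi / 2 * (3 * b₅ + a₄ + b₃ + 2 * a₂ * b₂ + a₁ * a₂ - b₁ * b₂)) := by
  set E₁ : ℝ × ℝ → ℝ := fun p => (F p).1 - (-p.2 + (a₁ * (p.1 * p.2) + a₂ * p.2 ^ 2) +
      (a₃ * (p.1 ^ 2 * p.2) + a₄ * (p.1 * p.2 ^ 2) + a₅ * p.2 ^ 3)) with hE₁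
  set E₂ : ℝ × ℝ → ℝ := fun p => (F p).2 - (p.1 + (b₁ * (p.1 * p.2) + b₂ * p.2 ^ 2) +
      (b₃ * (p.1 ^ 2 * p.2) + b₄ * (p.1 * p.2 ^ 2) + b₅ * p.2 ^ 3)) with hE₂
  have hF₁ : ∀ p, (F p).1 = -p.2 + (a₁ * (p.1 * p.2) + a₂ * p.2 ^ 2) +
      (a₃ * (p.1 ^ 2 * p.2) + a₄ * (p.1 * p.2 ^ 2) + a₅ * p.2 ^ 3) + E₁ p := by
    intro p; simp only [hE₁]; ring
  have hF₂ : ∀ p, (F p).2 = p.1 + (b₁ * (p.1 * p.2) + b₂ * p.2 ^ 2) +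
      (b₃ * (p.1 ^ 2 * p.2) + b₄ * (p.1 * p.2 ^ 2) + b₅ * p.2 ^ 3) + E₂ p := by
    intro p; simp only [hE₂]; ring
  have hquad : ∀ u v : ℝ, (fun p : ℝ × ℝ => u * (p.1 * p.2) + v * p.2 ^ 2) =O[𝓝 0]
      fun p => ‖p‖ ^ 2 := fun u v => by
    simpa using (isBigO_monomial u (i := 1) (j := 1) le_rfl).add
      (isBigO_monomial v (i := 0) (j := 2) le_rfl)
  have hcub : ∀ u v w : ℝ, (fun p : ℝ × ℝ => u * (p.1 ^ 2 * p.2) + v * (p.1 * p.2 ^ 2) +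
      w * p.2 ^ 3) =O[𝓝 0] fun p => ‖p‖ ^ 3 := fun u v w => by
    simpa using ((isBigO_monomial u (i := 2) (j := 1) le_rfl).add
      (isBigO_monomial v (i := 1) (j := 2) le_rfl)).add
      (isBigO_monomial w (i := 0) (j := 3) le_rfl)
  -- Undetermined coefficients: `A`, `D` and the coefficient `b₂` of `x y²` kill the cubic part of
  -- the derivative of `V` along the field. In degree 4, `e₀`, `e₃`, `e₄` match `x³y`, `y⁴`, `xy³`,
  -- and the `x²y²` equation then forces the value of `L`. No `x²y²` term is needed in `V`, as the
  -- rotation annihilates `(x² + y²)²`.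
  obtain ⟨L, hL⟩ : ∃ L, L = (3 * b₅ + a₄ + b₃ + 2 * a₂ * b₂ + a₁ * a₂ - b₁ * b₂) / 8 := ⟨_, rfl⟩
  obtain ⟨A, hA⟩ : ∃ A, A = (a₁ + 2 * b₂) / 3 := ⟨_, rfl⟩
  obtain ⟨D, hD⟩ : ∃ D, D = -(a₂ + b₁) / 3 := ⟨_, rfl⟩
  obtain ⟨e₀, he₀⟩ : ∃ e, e = (3 * A * a₁ + a₃) / 4 := ⟨_, rfl⟩
  obtain ⟨e₃, he₃⟩ : ∃ e, e = b₂ * a₂ + 3 * D * b₂ + b₅ - L := ⟨_, rfl⟩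
  obtain ⟨e₄, he₄⟩ : ∃ e, e = -(b₂ * a₁ + 2 * b₂ * b₂ + 3 * D * b₁ + a₅ + b₄) / 4 := ⟨_, rfl⟩
  let V : ℝ × ℝ → ℝ := fun p => 2⁻¹ * p.1 ^ 2 + 2⁻¹ * p.2 ^ 2 +
    (A * p.1 ^ 3 + b₂ * (p.1 * p.2 ^ 2) + D * p.2 ^ 3) +
    (e₀ * p.1 ^ 4 + L * (p.1 ^ 3 * p.2) + e₃ * (p.1 * p.2 ^ 3) + e₄ * p.2 ^ 4)
  -- Homogeneous parts of degree 2 and 3 of the partial derivatives of `V`.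
  let X₂ : ℝ × ℝ → ℝ := fun p => 3 * A * p.1 ^ 2 + b₂ * p.2 ^ 2
  let X₃ : ℝ × ℝ → ℝ := fun p => 4 * e₀ * p.1 ^ 3 + 3 * L * (p.1 ^ 2 * p.2) + e₃ * p.2 ^ 3
  let Y₂ : ℝ × ℝ → ℝ := fun p => 2 * b₂ * (p.1 * p.2) + 3 * D * p.2 ^ 2
  let Y₃ : ℝ × ℝ → ℝ := fun p => L * p.1 ^ 3 + 3 * e₃ * (p.1 * p.2 ^ 2) + 4 * e₄ * p.2 ^ 3
  let V' : ℝ × ℝ → ℝ × ℝ →L[ℝ] ℝ := fun p =>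
    (p.1 + X₂ p + X₃ p) • ContinuousLinearMap.fst ℝ ℝ ℝ +
      (p.2 + Y₂ p + Y₃ p) • ContinuousLinearMap.snd ℝ ℝ ℝ
  have hV : ∀ p, HasFDerivAt V (V' p) p := by
    intro p
    have hx : HasFDerivAt (fun q : ℝ × ℝ => q.1) (ContinuousLinearMap.fst ℝ ℝ ℝ) p :=
      hasFDerivAt_fst
    have hy : HasFDerivAt (fun q : ℝ × ℝ => q.2) (ContinuousLinearMap.snd ℝ ℝ ℝ) p :=
      hasFDerivAt_snd
    have h : HasFDerivAt V _ p := ((((hx.pow 2).const_mul 2⁻¹).add ((hy.pow 2).const_mul 2⁻¹)).add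
      ((((hx.pow 3).const_mul A).add ((hx.mul (hy.pow 2)).const_mul b₂)).add
        ((hy.pow 3).const_mul D))).add
      (((((hx.pow 4).const_mul e₀).add (((hx.pow 3).mul hy).const_mul L)).add
        ((hx.mul (hy.pow 3)).const_mul e₃)).add ((hy.pow 4).const_mul e₄))
    refine h.congr_fderiv (ContinuousLinearMap.ext fun q => ?_)
    simp [V', X₂, X₃, Y₂, Y₃]
    ring
  have hX₂ : X₂ =O[𝓝 0] fun p => ‖p‖ ^ 2 := by
    simpa [X₂] using (isBigO_monomial (3 * A) (i := 2) (j := 0) le_rfl).add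
      (isBigO_monomial b₂ (i := 0) (j := 2) le_rfl)
  have hY₂ : Y₂ =O[𝓝 0] fun p => ‖p‖ ^ 2 := hquad _ _
  have hX₃ : X₃ =O[𝓝 0] fun p => ‖p‖ ^ 3 := by
    simpa [X₃] using ((isBigO_monomial (4 * e₀) (i := 3) (j := 0) le_rfl).add
      (isBigO_monomial (3 * L) (i := 2) (j := 1) le_rfl)).add
      (isBigO_monomial e₃ (i := 0) (j := 3) le_rfl)
  have hY₃ : Y₃ =O[𝓝 0] fun p => ‖p‖ ^ 3 := by
    simpa [Y₃] using ((isBigO_monomial L (i := 3) (j := 0) le_rfl).add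
      (isBigO_monomial (3 * e₃) (i := 1) (j := 2) le_rfl)).add
      (isBigO_monomial (4 * e₄) (i := 0) (j := 3) le_rfl)
  have hx₁ : (fun p : ℝ × ℝ => p.1) =O[𝓝 0] fun p => ‖p‖ ^ 1 := by
    simpa using isBigO_monomial 1 (i := 1) (j := 0) (n := 1) le_rfl
  have hy₁ : (fun p : ℝ × ℝ => p.2) =O[𝓝 0] fun p => ‖p‖ ^ 1 := by
    simpa using isBigO_monomial 1 (i := 0) (j := 1) (n := 1) le_rfl
  have hle : ∀ {f : ℝ × ℝ → ℝ} {m n : ℕ}, f =O[𝓝 0] (fun p => ‖p‖ ^ n) → m ≤ n →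
      f =O[𝓝 0] fun p => ‖p‖ ^ m := fun hf h => hf.trans (isBigO_norm_pow_of_le h)
  have hmul : ∀ {f g : ℝ × ℝ → ℝ} {m n : ℕ}, f =O[𝓝 0] (fun p => ‖p‖ ^ m) →
      g =O[𝓝 0] (fun p => ‖p‖ ^ n) → 5 ≤ m + n →
      (fun p => f p * g p) =O[𝓝 0] fun p => ‖p‖ ^ 5 := fun hf hg h =>
    hle ((hf.mul hg).congr_right fun p => (pow_add _ _ _).symm) h
  have hlin : (fun p : ℝ × ℝ => F p - (-p.2, p.1)) =O[𝓝 0] fun p => ‖p‖ ^ 2 := by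
    refine IsBigO.prod_left ?_ ?_
    · refine (((hquad a₁ a₂).add (hle (hcub a₃ a₄ a₅) (by norm_num))).add
        (hle h₁ (by norm_num))).congr_left fun p => ?_
      rw [hF₁]
      ring
    · refine (((hquad b₁ b₂).add (hle (hcub b₃ b₄ b₅) (by norm_num))).add
        (hle h₂ (by norm_num))).congr_left fun p => ?_
      rw [hF₂]
      ring
  have hVF : (fun p : ℝ × ℝ => V' p (F p) - L * (p.1 ^ 2 + p.2 ^ 2) ^ 2) =O[𝓝 0]
      fun p => ‖p‖ ^ 5 := by
    have hVx : (fun p => p.1 + X₂ p + X₃ p) =O[𝓝 0] fun p => ‖p‖ ^ 1 :=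
      (hx₁.add (hle hX₂ (by norm_num))).add (hle hX₃ (by norm_num))
    have hVy : (fun p => p.2 + Y₂ p + Y₃ p) =O[𝓝 0] fun p => ‖p‖ ^ 1 :=
      (hy₁.add (hle hY₂ (by norm_num))).add (hle hY₃ (by norm_num))
    -- These are all the products of order at least 5; those of degree at most 4 cancel against `L
    -- r⁴` by the choice of coefficients.
    have hsum := ((hmul hVx h₁ (by norm_num)).add (hmul hVy h₂ (by norm_num))).add
      (((hmul (hX₂.add (hle hX₃ (by norm_num))) (hcub a₃ a₄ a₅) (by norm_num)).add
        (hmul hX₃ (hquad a₁ a₂) (by norm_num))).add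
      ((hmul (hY₂.add (hle hY₃ (by norm_num))) (hcub b₃ b₄ b₅) (by norm_num)).add
        (hmul hY₃ (hquad b₁ b₂) (by norm_num))))
    refine hsum.congr_left fun p => ?_
    simp only [V', add_apply, smul_apply,
      ContinuousLinearMap.coe_fst', ContinuousLinearMap.coe_snd', smul_eq_mul]
    rw [hF₁, hF₂]
    simp only [X₂, X₃, Y₂, Y₃]
    rw [he₃, he₀, he₄, hA, hD, hL]
    ring
  have hVx : ∀ x, V (x, 0) = x ^ 2 / 2 + A * x ^ 3 + e₀ * x ^ 4 := by
    intro x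
    simp only [V]
    ring
  convert isLiapunovNumber_of_energy hF hlin hV hVF hVx using 1
  rw [hL]
  ring

end Jet

/-! ### The 3-jet of the boundary polynomial -/

section Coefficients

variable {V : Type*} [Fintype V] [DecidableEq V] (G : SimpleGraph V) [DecidableRel G.Adj]

@[simp]
theorem mem_boundary {S : Finset V} {v : V} : v ∈ boundary G S ↔ v ∉ S ∧ ∃ u ∈ S, G.Adj u v := by
  simp [boundary]

@[simp]
theorem boundary_empty : boundary G ∅ = ∅ := by
  ext; simp

theorem boundaryCoeff_zero_zero : boundaryCoeff G 0 0 = 1 := by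
  rw [boundaryCoeff, Finset.card_eq_one]
  refine ⟨∅, Finset.ext fun S => ?_⟩
  simp only [Finset.mem_filter, Finset.mem_univ, true_and, Finset.card_eq_zero,
    Finset.mem_singleton]
  exact ⟨fun h => h.2, fun h => by simp [h]⟩

theorem boundaryCoeff_zero_right {i : ℕ} (hi : i ≠ 0) : boundaryCoeff G i 0 = 0 := by
  rw [boundaryCoeff, Finset.card_eq_zero, Finset.filter_eq_empty_iff]
  rintro S - ⟨h, hS⟩
  rw [Finset.card_eq_zero] at hS
  rw [hS, boundary_empty, Finset.card_empty] at h
  exact hi h.symm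

theorem boundary_singleton (v : V) : boundary G {v} = G.neighborFinset v := by
  ext u
  simp only [mem_boundary, Finset.mem_singleton, exists_eq_left, SimpleGraph.mem_neighborFinset]
  exact ⟨fun h => h.2, fun h => ⟨h.ne', h⟩⟩

theorem boundaryCoeff_one_right (i : ℕ) :
    boundaryCoeff G i 1 = (Finset.univ.filter fun v => G.degree v = i).card := by
  have : (Finset.univ.filter fun S : Finset V => (boundary G S).card = i ∧ S.card = 1) =
      (Finset.univ.filter fun v => G.degree v = i).map
        ⟨fun v => {v}, Finset.singleton_injective⟩ := by
    ext S
    simp only [Finset.mem_filter, Finset.mem_univ, true_and, Finset.mem_map,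
      Function.Embedding.coeFn_mk]
    constructor
    · rintro ⟨h, hS⟩
      obtain ⟨v, rfl⟩ := Finset.card_eq_one.1 hS
      exact ⟨v, by rwa [boundary_singleton] at h, rfl⟩
    · rintro ⟨v, hv, rfl⟩
      exact ⟨by rwa [boundary_singleton], Finset.card_singleton v⟩
  rw [boundaryCoeff, this, Finset.card_map]

/-- The 3-jet of the boundary polynomial of a graph without isolated vertices. -/
theorem boundaryPoly_sub_jet_isBigO (hG : ∀ v, G.degree v ≠ 0) :
    (fun p : ℝ × ℝ => boundaryPoly G p.1 p.2 - 1 -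
      ((boundaryCoeff G 1 1 * (p.1 * p.2) + boundaryCoeff G 0 2 * p.2 ^ 2) +
      (boundaryCoeff G 2 1 * (p.1 ^ 2 * p.2) + boundaryCoeff G 1 2 * (p.1 * p.2 ^ 2) +
        boundaryCoeff G 0 3 * p.2 ^ 3))) =O[𝓝 0] fun p => ‖p‖ ^ 4 := by
  -- A singleton with empty boundary is an isolated vertex. This removes the linear term in `y`, so
  -- the linear part of the field is the pure rotation.
  have h01 : boundaryCoeff G 0 1 = 0 := by
    rw [boundaryCoeff_one_right, Finset.card_eq_zero, Finset.filter_eq_empty_iff]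
    exact fun v _ => hG v
  let small : Finset (Finset V) := Finset.univ.filter fun S => (boundary G S).card + S.card ≤ 3
  have hsmall : ∀ x y : ℝ, ∑ S ∈ small, x ^ (boundary G S).card * y ^ S.card =
      1 + ((boundaryCoeff G 1 1 * (x * y) + boundaryCoeff G 0 2 * y ^ 2) +
      (boundaryCoeff G 2 1 * (x ^ 2 * y) + boundaryCoeff G 1 2 * (x * y ^ 2) +
        boundaryCoeff G 0 3 * y ^ 3)) := by
    intro x y
    let T : Finset (ℕ × ℕ) :=
      {(0, 0), (1, 0), (2, 0), (3, 0), (0, 1), (1, 1), (2, 1), (0, 2), (1, 2), (0, 3)}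
    have hmaps : ∀ S ∈ small, ((boundary G S).card, S.card) ∈ T := by
      intro S hS
      have hS : (boundary G S).card + S.card ≤ 3 := by simpa [small] using hS
      generalize (boundary G S).card = i at *
      generalize S.card = j at *
      have hi : i ≤ 3 := by omega
      have hj : j ≤ 3 := by omega
      interval_cases i <;> interval_cases j <;> first | omega | simp [T]
    rw [← Finset.sum_fiberwise_of_maps_to hmaps]
    have hfib : ∀ q ∈ T, ∑ S ∈ small with ((boundary G S).card, S.card) = q,
        x ^ (boundary G S).card * y ^ S.card = boundaryCoeff G q.1 q.2 * (x ^ q.1 * y ^ q.2) := by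
      intro q hq
      have hq3 : q.1 + q.2 ≤ 3 := by
        revert q; decide
      rw [Finset.sum_congr rfl (g := fun _ => x ^ q.1 * y ^ q.2), Finset.sum_const, nsmul_eq_mul,
        boundaryCoeff]
      · congr 3
        ext S
        simp only [small, Finset.mem_filter, Finset.mem_univ, true_and, Prod.ext_iff]
        omega
      · intro S hS
        rw [← (Finset.mem_filter.1 hS).2]
    rw [Finset.sum_congr rfl hfib]
    simp [T, h01, boundaryCoeff_zero_zero, boundaryCoeff_zero_right]
    ring
  have hrest : (fun p : ℝ × ℝ => ∑ S with ¬ (boundary G S).card + S.card ≤ 3,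
      p.1 ^ (boundary G S).card * p.2 ^ S.card) =O[𝓝 0] fun p => ‖p‖ ^ 4 := by
    refine Asymptotics.IsBigO.fun_sum fun S hS => ?_
    have hS := (Finset.mem_filter.1 hS).2
    simpa using isBigO_monomial 1 (i := (boundary G S).card) (j := S.card) (n := 4) (by omega)
  refine hrest.congr_left fun p => ?_
  have := hsmall p.1 p.2
  rw [boundaryPoly, ← Finset.sum_filter_add_sum_filter_not Finset.univ
    (fun S => (boundary G S).card + S.card ≤ 3), this]
  ring

theorem contDiff_boundaryPoly {n : WithTop ℕ∞} :
    ContDiff ℝ n fun p : ℝ × ℝ => boundaryPoly G p.1 p.2 := by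
  unfold boundaryPoly
  fun_prop

/-- The Liapunov number of the boundary polynomial system of two graphs without isolated
vertices. -/
theorem isLiapunovNumber_hopfField {W : Type*} [Fintype W] [DecidableEq W] (H : SimpleGraph W)
    [DecidableRel H.Adj] (hG : ∀ v, G.degree v ≠ 0) (hH : ∀ v, H.degree v ≠ 0) :
    IsLiapunovNumber (hopfField 0 G H) (sigmaB G H) := by
  have hF : ContDiff ℝ 1 (hopfField 0 G H) := by
    have h1 := contDiff_boundaryPoly G (n := 1)
    have h2 := contDiff_boundaryPoly H (n := 1)
    unfold hopfField
    fun_prop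
  -- These three coefficients do not occur in the Liapunov number, so the goal cannot determine
  -- them.
  refine isLiapunovNumber_of_jet hF
    (a₃ := boundaryCoeff G 2 1) (a₅ := boundaryCoeff G 0 3) (b₄ := boundaryCoeff H 1 2)
    ((boundaryPoly_sub_jet_isBigO G hG).congr_left fun p => ?_)
    ((boundaryPoly_sub_jet_isBigO H hH).congr_left fun p => ?_)
  · simp only [hopfField]
    ring
  · simp only [hopfField]
    ring

end Coefficients

/-! ### Complete graphs, wheels, cycles and stars -/

section Families

variable {V : Type*} [Fintype V] [DecidableEq V] (G : SimpleGraph V) [DecidableRel G.Adj]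

theorem boundaryCoeff_eq_zero {i j : ℕ}
    (h : ∀ S : Finset V, S.card = j → (boundary G S).card ≠ i) : boundaryCoeff G i j = 0 := by
  rw [boundaryCoeff, Finset.card_eq_zero, Finset.filter_eq_empty_iff]
  exact fun S _ hS => h S hS.2 hS.1

/-- A set with empty boundary is closed under walks, so in a connected graph it is empty or
everything. -/
theorem boundaryCoeff_zero_left (hG : G.Preconnected) {j : ℕ} (hj : j ≠ 0)
    (hj' : j ≠ Fintype.card V) : boundaryCoeff G 0 j = 0 := by
  refine boundaryCoeff_eq_zero G fun S hS hB => hj' ?_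
  rw [Finset.card_eq_zero] at hB
  have hclosed : ∀ u v, G.Walk u v → u ∈ S → v ∈ S := by
    intro u v p
    induction p with
    | nil => exact id
    | @cons a b _ hab _ ih =>
      intro ha
      refine ih (by_contra fun hb => ?_)
      have : b ∈ boundary G S := (mem_boundary G).2 ⟨hb, a, ha, hab⟩
      simp [hB] at this
  obtain ⟨u, hu⟩ : S.Nonempty := by
    rw [← Finset.card_pos]
    omega
  have : S = Finset.univ := Finset.eq_univ_iff_forall.2 fun v =>
    let ⟨p⟩ := hG u v
    hclosed u v p hu
  rw [← hS, this, Finset.card_univ]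

/-- The vertices of a pair with a single boundary vertex only have each other and that vertex as
neighbours. -/
theorem neighborFinset_subset_of_boundary_pair {u v b : V}
    (h : boundary G {u, v} = {b}) : G.neighborFinset u ⊆ {v, b} := by
  intro x hx
  rw [SimpleGraph.mem_neighborFinset] at hx
  rw [Finset.mem_insert]
  refine or_iff_not_imp_left.2 fun hxv => ?_
  rw [← h, mem_boundary]
  exact ⟨by simp [hx.ne', hxv], u, by simp, hx⟩

theorem boundaryCoeff_one_two_eq_zero (h : ∀ u v b : V, u ≠ v → ¬ (boundary G {u, v} = {b})) :
    boundaryCoeff G 1 2 = 0 := by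
  refine boundaryCoeff_eq_zero G fun S hS hB => ?_
  obtain ⟨u, v, huv, rfl⟩ := Finset.card_eq_two.1 hS
  obtain ⟨b, hb⟩ := Finset.card_eq_one.1 hB
  exact h u v b huv hb

/-- For equal graphs the two products `B_{1,1} B_{0,2}` cancel. -/
theorem sigmaBEq_self {v : ℝ} (hG : ∀ v, G.degree v ≠ 0)
    (h : 3 * Real.pi / 2 * (3 * (boundaryCoeff G 0 3 : ℝ) + boundaryCoeff G 1 2 +
      boundaryCoeff G 2 1 + 2 * (boundaryCoeff G 0 2 : ℝ) ^ 2) = v) :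
    SigmaBEq G G v := by
  have hσ : sigmaB G G = v := by
    rw [← h, sigmaB]
    ring
  exact ⟨hσ ▸ isLiapunovNumber_hopfField G G hG hG, hσ⟩

/-- Connected graphs with minimum degree at least three have Liapunov number zero. -/
theorem sigmaBEq_zero_of_three_le_degree (hc : G.Preconnected) (hV : 4 ≤ Fintype.card V)
    (hd : ∀ v, 3 ≤ G.degree v) : SigmaBEq G G 0 := by
  have h21 : boundaryCoeff G 2 1 = 0 := by
    rw [boundaryCoeff_one_right, Finset.card_eq_zero, Finset.filter_eq_empty_iff]
    intro v _
    have := hd v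
    omega
  have h12 : boundaryCoeff G 1 2 = 0 := by
    refine boundaryCoeff_one_two_eq_zero G fun u v b _ hB => ?_
    have h1 := Finset.card_le_card (neighborFinset_subset_of_boundary_pair G hB)
    rw [SimpleGraph.card_neighborFinset_eq_degree] at h1
    have h2 := hd u
    have h3 := Finset.card_le_two (a := v) (b := b)
    omega
  refine sigmaBEq_self G (fun v => by have := hd v; omega) ?_
  rw [h21, h12, boundaryCoeff_zero_left G hc (by norm_num) (by omega),
    boundaryCoeff_zero_left G hc (by norm_num) (by omega)]
  simp

theorem sigmaBEq_top {n : ℕ} (hn : 4 ≤ n) :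
    SigmaBEq (⊤ : SimpleGraph (Fin n)) (⊤ : SimpleGraph (Fin n)) 0 := by
  refine sigmaBEq_zero_of_three_le_degree _ SimpleGraph.preconnected_top (by simpa) fun v => ?_
  rw [SimpleGraph.complete_graph_degree, Fintype.card_fin]
  omega

theorem fin_add_one_ne_sub_one {n : ℕ} (i : Fin (n + 3)) : i + 1 ≠ i - 1 := by
  intro h
  have h2 : (1 : Fin (n + 3)) + 1 = 0 := by
    calc (1 : Fin (n + 3)) + 1 = (i + 1) - (i - 1) := by abel
      _ = 0 := by rw [h, sub_self]
  have := congrArg Fin.val h2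
  simp [Fin.val_add, Nat.mod_eq_of_lt (show 2 < n + 3 by omega)] at this

/-- A rim vertex sees the hub and two distinct rim neighbours, and the hub sees at least three rim
vertices, so all degrees are at least 3. -/
theorem sigmaBEq_wheelGraph {n : ℕ} (hn : 4 ≤ n) : SigmaBEq (wheelGraph n) (wheelGraph n) 0 := by
  obtain ⟨m, rfl⟩ := Nat.exists_eq_add_of_le' hn
  have hub : (wheelGraph (m + 4)).IsUniversal none := by
    rintro (_ | j) hj
    · exact absurd rfl hj
    · trivial
  refine sigmaBEq_zero_of_three_le_degree _
    (SimpleGraph.Connected.of_isUniversal hub).preconnected (by simp) fun v => ?_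
  rw [← SimpleGraph.card_neighborFinset_eq_degree]
  rcases v with _ | i
  · have : Finset.univ.map Function.Embedding.some ⊆ (wheelGraph (m + 4)).neighborFinset none := by
      intro x hx
      obtain ⟨j, -, rfl⟩ := Finset.mem_map.1 hx
      rw [SimpleGraph.mem_neighborFinset]
      trivial
    have := Finset.card_le_card this
    rw [Finset.card_map, Finset.card_univ, Fintype.card_fin] at this
    omega
  · change Fin (m + 3) at i
    have hsub : {none, some (i + 1), some (i - 1)} ⊆
        (wheelGraph (m + 4)).neighborFinset (some i) := by
      intro x hx
      rw [SimpleGraph.mem_neighborFinset]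
      simp only [Finset.mem_insert, Finset.mem_singleton] at hx
      rcases hx with rfl | rfl | rfl
      · trivial
      · change (SimpleGraph.cycleGraph (m + 1 + 2)).Adj i (i + 1)
        rw [SimpleGraph.cycleGraph_adj]
        exact Or.inr (by abel)
      · change (SimpleGraph.cycleGraph (m + 1 + 2)).Adj i (i - 1)
        rw [SimpleGraph.cycleGraph_adj]
        exact Or.inl (by abel)
    have hcard : ({none, some (i + 1), some (i - 1)} : Finset (Option (Fin (m + 3)))).card = 3 := by
      rw [Finset.card_insert_of_notMem (by simp), Finset.card_pair]
      simpa using fin_add_one_ne_sub_one i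
    exact hcard ▸ Finset.card_le_card hsub

/-- Three steps of `±1` have an odd sum of absolute value at most 3, which is nonzero modulo `n +
4`. -/
theorem not_cycleGraph_triangle {n : ℕ} {u v w : Fin (n + 4)}
    (huv : (SimpleGraph.cycleGraph (n + 4)).Adj u v)
    (huw : (SimpleGraph.cycleGraph (n + 4)).Adj u w)
    (hvw : (SimpleGraph.cycleGraph (n + 4)).Adj v w) : False := by
  have hval : ∀ {a b : Fin (n + 4)}, (SimpleGraph.cycleGraph (n + 4)).Adj a b →
      a.val + 1 = b.val ∨ b.val + 1 = a.val ∨ (a.val = 0 ∧ b.val = n + 3) ∨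
        (b.val = 0 ∧ a.val = n + 3) := by
    have hsub : ∀ {a b : Fin (n + 4)}, a - b = 1 →
        b.val + 1 = a.val ∨ (a.val = 0 ∧ b.val = n + 3) := by
      intro a b h
      rw [sub_eq_iff_eq_add'] at h
      rw [h, Fin.val_add_one]
      split_ifs with hb
      · right; simp [hb]
      · left; rfl
    intro a b h
    rcases SimpleGraph.cycleGraph_adj.1 h with h | h
    · rcases hsub h with h | h <;> omega
    · rcases hsub h with h | h <;> omega
  have h1 := hval huv
  have h2 := hval huw
  have h3 := hval hvw
  omega

theorem sigmaBEq_cycleGraph {n : ℕ} (hn : 4 ≤ n) :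
    SigmaBEq (SimpleGraph.cycleGraph n) (SimpleGraph.cycleGraph n) (3 * (n : ℝ) * Real.pi / 2) := by
  obtain ⟨m, rfl⟩ := Nat.exists_eq_add_of_le' hn
  have hd : ∀ v, (SimpleGraph.cycleGraph (m + 4)).degree v = 2 := fun v =>
    SimpleGraph.cycleGraph_degree_three_le
  have hc : (SimpleGraph.cycleGraph (m + 4)).Preconnected := SimpleGraph.cycleGraph_preconnected
  have h21 : boundaryCoeff (SimpleGraph.cycleGraph (m + 4)) 2 1 = m + 4 := by
    rw [boundaryCoeff_one_right, Finset.filter_true_of_mem fun v _ => hd v, Finset.card_univ,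
      Fintype.card_fin]
  have h12 : boundaryCoeff (SimpleGraph.cycleGraph (m + 4)) 1 2 = 0 := by
    refine boundaryCoeff_one_two_eq_zero _ fun u v b huv hB => ?_
    -- Since degrees are 2, the inclusion of the neighbourhood in `{y, b}` is an equality. Applied
    -- to both vertices of the pair, it makes `u`, `v`, `b` a triangle.
    have heq : ∀ {x y : Fin (m + 4)},
        boundary (SimpleGraph.cycleGraph (m + 4)) {x, y} = {b} →
        (SimpleGraph.cycleGraph (m + 4)).neighborFinset x = {y, b} := fun h =>
      Finset.eq_of_subset_of_card_le (neighborFinset_subset_of_boundary_pair _ h) (by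
        rw [SimpleGraph.card_neighborFinset_eq_degree, hd]
        exact Finset.card_le_two)
    have hu := heq hB
    have hv := heq (Finset.pair_comm u v ▸ hB)
    have huv : v ∈ (SimpleGraph.cycleGraph (m + 4)).neighborFinset u := by simp [hu]
    have hub : b ∈ (SimpleGraph.cycleGraph (m + 4)).neighborFinset u := by simp [hu]
    have hvb : b ∈ (SimpleGraph.cycleGraph (m + 4)).neighborFinset v := by simp [hv]
    rw [SimpleGraph.mem_neighborFinset] at huv hub hvb
    exact not_cycleGraph_triangle huv hub hvb
  refine sigmaBEq_self _ (fun v => by rw [hd]; norm_num) ?_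
  rw [h21, h12, boundaryCoeff_zero_left _ hc (by norm_num) (by simp),
    boundaryCoeff_zero_left _ hc (by norm_num) (by simp)]
  push_cast
  ring

theorem degree_starGraph_ne_zero [Nontrivial V] (c v : V) :
    (SimpleGraph.starGraph c).degree v ≠ 0 :=
  ((SimpleGraph.connected_starGraph c).preconnected.degree_pos_of_nontrivial v).ne'

/-- Exceptional because the whole vertex set contributes to `B_{0,2}`. -/
theorem sigmaBEq_starGraph_two (c : Fin 2) :
    SigmaBEq (SimpleGraph.starGraph c) (SimpleGraph.starGraph c) (3 * Real.pi) := by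
  have h : ∀ c : Fin 2, boundaryCoeff (SimpleGraph.starGraph c) 0 3 = 0 ∧
      boundaryCoeff (SimpleGraph.starGraph c) 1 2 = 0 ∧
      boundaryCoeff (SimpleGraph.starGraph c) 2 1 = 0 ∧
      boundaryCoeff (SimpleGraph.starGraph c) 0 2 = 1 := by decide
  obtain ⟨h03, h12, h21, h02⟩ := h c
  refine sigmaBEq_self _ (degree_starGraph_ne_zero c) ?_
  rw [h03, h12, h21, h02]
  push_cast
  ring

/-- Exceptional because the whole vertex set contributes to `B_{0,3}`, the centre has degree 2, and
pairs containing the centre also have a single boundary vertex. -/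
theorem sigmaBEq_starGraph_three (c : Fin 3) :
    SigmaBEq (SimpleGraph.starGraph c) (SimpleGraph.starGraph c) (21 * Real.pi / 2) := by
  have h : ∀ c : Fin 3, boundaryCoeff (SimpleGraph.starGraph c) 0 3 = 1 ∧
      boundaryCoeff (SimpleGraph.starGraph c) 1 2 = 3 ∧
      boundaryCoeff (SimpleGraph.starGraph c) 2 1 = 1 ∧
      boundaryCoeff (SimpleGraph.starGraph c) 0 2 = 0 := by decide
  obtain ⟨h03, h12, h21, h02⟩ := h c
  refine sigmaBEq_self _ (degree_starGraph_ne_zero c) ?_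
  rw [h03, h12, h21, h02]
  push_cast
  ring

theorem boundary_starGraph_of_notMem {c : V} {S : Finset V} (hc : c ∉ S) (hS : S.Nonempty) :
    boundary (SimpleGraph.starGraph c) S = {c} := by
  obtain ⟨u, hu⟩ := hS
  ext v
  simp only [mem_boundary, SimpleGraph.starGraph_adj, Finset.mem_singleton]
  constructor
  · rintro ⟨-, w, hw, -, rfl | rfl⟩
    · exact absurd hw hc
    · rfl
  · rintro rfl
    exact ⟨hc, u, hu, fun h => hc (h ▸ hu), Or.inr rfl⟩

theorem boundary_starGraph_of_mem {c : V} {S : Finset V} (hc : c ∈ S) :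
    boundary (SimpleGraph.starGraph c) S = Sᶜ := by
  ext v
  simp only [mem_boundary, SimpleGraph.starGraph_adj, Finset.mem_compl]
  exact ⟨fun h => h.1, fun h => ⟨h, c, hc, fun hcv => h (hcv ▸ hc), Or.inl rfl⟩⟩

/-- A pair of leaves has only the centre as boundary, while a pair containing the centre has at
least two boundary vertices once the order is at least 4. -/
theorem boundaryCoeff_starGraph_one_two (c : V) (hV : 4 ≤ Fintype.card V) :
    boundaryCoeff (SimpleGraph.starGraph c) 1 2 = (Fintype.card V - 1).choose 2 := by
  have : (Finset.univ.filter fun S : Finset V =>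
      (boundary (SimpleGraph.starGraph c) S).card = 1 ∧ S.card = 2) =
      (Finset.univ.erase c).powersetCard 2 := by
    ext S
    simp only [Finset.mem_filter, Finset.mem_univ, true_and, Finset.mem_powersetCard,
      Finset.subset_erase, Finset.subset_univ]
    refine and_congr_left fun hS => ?_
    by_cases hc : c ∈ S
    · rw [boundary_starGraph_of_mem hc, Finset.card_compl]
      simp only [hc, not_true_eq_false, iff_false]
      omega
    · rw [boundary_starGraph_of_notMem hc (by rw [← Finset.card_pos]; omega)]
      simp [hc]
  rw [boundaryCoeff, this, Finset.card_powersetCard, Finset.card_erase_of_mem (Finset.mem_univ c),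
    Finset.card_univ]

theorem sigmaBEq_starGraph {n : ℕ} (hn : 4 ≤ n) (c : Fin n) :
    SigmaBEq (SimpleGraph.starGraph c) (SimpleGraph.starGraph c)
      (3 * ((n : ℝ) - 1) * ((n : ℝ) - 2) * Real.pi / 4) := by
  have : Nontrivial (Fin n) := Fin.nontrivial_iff_two_le.2 (by omega)
  have hc := (SimpleGraph.connected_starGraph c).preconnected
  have h21 : boundaryCoeff (SimpleGraph.starGraph c) 2 1 = 0 := by
    rw [boundaryCoeff_one_right, Finset.card_eq_zero, Finset.filter_eq_empty_iff]
    intro v _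
    rcases eq_or_ne v c with rfl | hv
    · rw [SimpleGraph.degree_starGraph_center, Fintype.card_fin]
      omega
    · rw [SimpleGraph.degree_starGraph_of_ne_center hv]
      norm_num
  refine sigmaBEq_self _ (degree_starGraph_ne_zero c) ?_
  rw [h21, boundaryCoeff_starGraph_one_two c (by simpa),
    boundaryCoeff_zero_left _ hc (by norm_num) (by rw [Fintype.card_fin]; omega),
    boundaryCoeff_zero_left _ hc (by norm_num) (by rw [Fintype.card_fin]; omega),
    Fintype.card_fin, Nat.cast_choose_two, Nat.cast_sub (by omega)]
  push_cast
  ring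

end Families

end BoundaryHopf

theorem corollary3p9 :
    (∀ n : ℕ, 4 ≤ n →
      BoundaryHopf.SigmaBEq (⊤ : SimpleGraph (Fin n)) (⊤ : SimpleGraph (Fin n)) 0) ∧
    (∀ n : ℕ, 4 ≤ n →
      BoundaryHopf.SigmaBEq (BoundaryHopf.wheelGraph n) (BoundaryHopf.wheelGraph n) 0) ∧
    (∀ n : ℕ, 4 ≤ n →
      BoundaryHopf.SigmaBEq (SimpleGraph.cycleGraph n) (SimpleGraph.cycleGraph n)
        (3 * (n : ℝ) * Real.pi / 2)) ∧
    (∀ c : Fin 2,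
      BoundaryHopf.SigmaBEq (SimpleGraph.starGraph c) (SimpleGraph.starGraph c)
        (3 * Real.pi)) ∧
    (∀ c : Fin 3,
      BoundaryHopf.SigmaBEq (SimpleGraph.starGraph c) (SimpleGraph.starGraph c)
        (21 * Real.pi / 2)) ∧
    (∀ n : ℕ, 4 ≤ n → ∀ c : Fin n,
      BoundaryHopf.SigmaBEq (SimpleGraph.starGraph c) (SimpleGraph.starGraph c)
        (3 * ((n : ℝ) - 1) * ((n : ℝ) - 2) * Real.pi / 4)) :=
  ⟨fun _ hn => BoundaryHopf.sigmaBEq_top hn, fun _ hn => BoundaryHopf.sigmaBEq_wheelGraph hn,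
    fun _ hn => BoundaryHopf.sigmaBEq_cycleGraph hn, BoundaryHopf.sigmaBEq_starGraph_two,
    BoundaryHopf.sigmaBEq_starGraph_three, fun _ hn c => BoundaryHopf.sigmaBEq_starGraph hn c⟩
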